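/- For a finite group $G$, a $G$-transfer system is a partial order $\to$ on the set of subgroups of $G$ such that $K\to H$ implies $K\le H$; $K\to H$ and $L\le H$ imply $K\cap L\to H\cap L$; and $K\to H$ implies $gKg^{-1}\to gHg^{-1}$ for all $g\in G$. A set of relations $K\to H$ with $K\le H$ generates the complete transfer system (the one with $K\to H$ for all $K\le H$) if its closure under reflexivity, transitivity, restriction ($K\to H$, $L\le H$ give $K\cap L\to H\cap L$) and conjugation contains every $K\to H$ with $K\le H$. The width $w(G)$ is the cardinality of a minimal generating set of the complete transfer system. A proper subgroup of $G$ is meet irreducible if it is not the intersection of two strictly larger subgroups. Let $p$ be a prime, $n\ge 1$, $F=\mathbb{F}_{p^n}$, $V=(F,+)$, $H=F^\times$, and $G=\operatorname{AGL}(1,p^n)=V\rtimes H$, where $H$ acts on $V$ by multiplication. Then $$w(G)=\Omega(p^n-1)+\tau(n),$$ where $\Omega(m)$ is the number of prime factors of $m$ counted with multiplicity and $\tau(n)$ is the number of positive divisors of $n$. More precisely, both the least size of a generating set and the size of every inclusion-minimal generating set of the complete transfer system equal $\Omega(p^n-1)+\tau(n)$, and this is also the number of conjugacy classes of proper meet irreducible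 subgroups of $G$. The proper meet irreducible subgroups of $G$ are exactly the following: 1. the conjugates of the complement $H$ (one conjugacy class); 2. the subgroups $V\rtimes D$ with $D\le H$ such that the index $[H:D]$ is a prime power greater than $1$ ($\Omega(p^n-1)$ conjugacy classes); 3. the conjugates of the subgroups $A\rtimes L^\times$, where $L$ is a proper subfield of $F$ and $A$ is an $L$-subspace of $F$ of codimension one ($\tau(n)-1$ conjugacy classes). -/

import Mathlib

section TransferSystems

variable (G : Type*) [Group G]

/-- The conjugate `g K g⁻¹` of a subgroup. -/
def conjSubgroup {G : Type*} [Group G] (g : G) (K : Subgroup G) : Subgroup G :=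
  K.map (MulAut.conj g).toMonoidHom

/-- A `G`-transfer system: a partial order on the subgroups of `G` that refines inclusion and is
closed under restriction and conjugation (antisymmetry follows from `le`). -/
structure TransferSystem where
  /-- `rel K H` is the relation `K → H`. -/
  rel : Subgroup G → Subgroup G → Prop
  le : ∀ {K H}, rel K H → K ≤ H
  refl : ∀ H, rel H H
  trans : ∀ {L K H}, rel L K → rel K H → rel L H
  restrict : ∀ {K H L}, rel K H → L ≤ H → rel (K ⊓ L) (H ⊓ L)
  conj : ∀ {K H} (g : G), rel K H → rel (conjSubgroup g K) (conjSubgroup g H)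

/-- The complete transfer system, which contains every edge `K → H` with `K ≤ H`. -/
def completeTransferSystem : TransferSystem G where
  rel K H := K ≤ H
  le h := h
  refl _ := le_rfl
  trans := le_trans
  restrict h _ := inf_le_inf_right _ h
  conj _ h := Subgroup.map_mono h

/-- The closure of a collection `S` of edges (a pair `(K, H)` stands for `K → H`) under
reflexivity, transitivity, restriction and conjugation. -/
inductive TransferClosure {G : Type*} [Group G] (S : Set (Subgroup G × Subgroup G)) :
    Subgroup G → Subgroup G → Prop
  | basic {K H} : (K, H) ∈ S → TransferClosure S K H
  | refl (H) : TransferClosure S H H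
  | trans {L K H} : TransferClosure S L K → TransferClosure S K H → TransferClosure S L H
  | restrict {K H L} : TransferClosure S K H → L ≤ H → TransferClosure S (K ⊓ L) (H ⊓ L)
  | conj {K H} (g : G) : TransferClosure S K H →
      TransferClosure S (conjSubgroup g K) (conjSubgroup g H)

/-- The collection of edges `S` generates the transfer system `T`. -/
def TransferSystem.GeneratedBy {G : Type*} [Group G] (T : TransferSystem G)
    (S : Set (Subgroup G × Subgroup G)) : Prop :=
  ∀ K H, TransferClosure S K H ↔ T.rel K H

/-- The width of a (finite) group: the minimal size of a generating set of its complete transfer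
system. -/
noncomputable def width : ℕ :=
  sInf {k | ∃ S : Finset (Subgroup G × Subgroup G),
    (completeTransferSystem G).GeneratedBy (S : Set (Subgroup G × Subgroup G)) ∧ S.card = k}

/-- The conjugacy class of a subgroup. -/
def subgroupConjClass {G : Type*} [Group G] (K : Subgroup G) : Set (Subgroup G) :=
  {K' | ∃ g : G, K' = conjSubgroup g K}

/-- The number of conjugacy classes of the members of a family of subgroups. -/
noncomputable def numConjClasses {G : Type*} [Group G] (P : Set (Subgroup G)) : ℕ :=
  (subgroupConjClass '' P).ncard

end TransferSystems

section AffineGroup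

variable (F : Type*) [Field F]

/-- The action of `Fˣ` on the additive group of `F` by multiplication. -/
def affineAction : Fˣ →* MulAut (Multiplicative F) :=
  (MulAutMultiplicative F).symm.toMonoidHom.comp (DistribMulAction.toAddAut Fˣ F)

/-- The affine group `AGL(1, F) = F ⋊ Fˣ`; the pair `⟨v, u⟩` is the map `x ↦ u x + v`. -/
abbrev AGL1 : Type _ := Multiplicative F ⋊[affineAction F] Fˣ

variable {F}

theorem affineAction_apply (u : Fˣ) (v : Multiplicative F) :
    Multiplicative.toAdd (affineAction F u v) = (u : F) * Multiplicative.toAdd v := rfl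

/-- The subgroup `A ⋊ D` of `AGL(1, F)`, for an additive subgroup `A` of `F` that is normalised by
the subgroup `D` of `Fˣ`. -/
def semidirectSubgroup (A : AddSubgroup F) (D : Subgroup Fˣ)
    (h : ∀ d ∈ D, ∀ a ∈ A, (d : F) * a ∈ A) : Subgroup (AGL1 F) where
  carrier := {g | Multiplicative.toAdd g.left ∈ A ∧ g.right ∈ D}
  one_mem' := ⟨A.zero_mem, D.one_mem⟩
  mul_mem' := fun {a b} ha hb =>
    ⟨A.add_mem ha.1 (h a.right ha.2 _ hb.1), D.mul_mem ha.2 hb.2⟩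
  inv_mem' := fun {a} ha =>
    ⟨h a.right⁻¹ (D.inv_mem ha.2) _ (A.neg_mem ha.1), D.inv_mem ha.2⟩

/-- The complement `H = Fˣ` of the translation subgroup, that is, `0 ⋊ Fˣ`. -/
def pointStabilizer (F : Type*) [Field F] : Subgroup (AGL1 F) :=
  semidirectSubgroup ⊥ ⊤ (by simp)

/-- The subgroup `V ⋊ D`, where `V` is the whole additive group of `F`. -/
def translationExtension (D : Subgroup Fˣ) : Subgroup (AGL1 F) :=
  semidirectSubgroup ⊤ D (by simp)

/-- The subgroup `A ⋊ Lˣ`, for a subfield `L` of `F` and an `L`-subspace `A` of `F`. -/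
def subfieldSubgroup (L : Subfield F) (A : Submodule L F) : Subgroup (AGL1 F) :=
  semidirectSubgroup A.toAddSubgroup L.toSubmonoid.units
    (fun d hd _ ha => A.smul_mem (⟨(d : F), (Submonoid.mem_units_iff _ _).1 hd |>.1⟩ : L) ha)

variable (F)

/-- The conjugates of the complement `H`. -/
def complementFamily : Set (Subgroup (AGL1 F)) :=
  {K | ∃ g, K = conjSubgroup g (pointStabilizer F)}

/-- The subgroups `V ⋊ D` with `D` of prime power index (greater than `1`) in `Fˣ`. -/
def translationFamily : Set (Subgroup (AGL1 F)) :=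
  {K | ∃ D : Subgroup Fˣ, IsPrimePow D.index ∧ K = translationExtension D}

/-- The conjugates of the subgroups `A ⋊ Lˣ`, with `L` a proper subfield of `F` and `A` an
`L`-hyperplane of `F`. -/
def subfieldFamily : Set (Subgroup (AGL1 F)) :=
  {K | ∃ (L : Subfield F) (A : Submodule L F) (g : AGL1 F), L ≠ ⊤ ∧
    Module.finrank L A + 1 = Module.finrank L F ∧ K = conjSubgroup g (subfieldSubgroup L A)}

end AffineGroup

/-!
For any finite group the complete transfer system is generated by a set of inclusions exactly when
that set contains, for each conjugacy class of meet irreducible proper subgroups, a strict inclusion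
out of some member of the class (`generatedBy_completeTransferSystem_iff`). Such edges are needed,
because no restriction, composition or conjugation produces a strict inclusion out of a conjugate of
a meet irreducible `M` from edges that have none (`TransferClosure.not_strict`). They suffice: by
induction from the top, `K → G` is obtained from an edge `K → H` with `K < H` when `K` is meet
irreducible, and from `A → G` and `B → G` when `K = A ⊓ B`. Hence the width, and the size of every
minimal generating set, is the number of classes of meet irreducible proper subgroups.

In `AGL(1, F)` every subgroup is conjugate to some `A ⋊ D` with `A ≤ F` and `D ≤ Fˣ`, because `D` is
cyclic and an affine map with linear coefficient different from `1` has a fixed point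
(`exists_conjSubgroup_eq_semidirectSubgroup`). If `A = F`, then only `D` matters, and a subgroup of
a finite cyclic group is meet irreducible exactly when its index is a prime power greater than `1`
(`infIrred_iff_isPrimePow_index`). If `A ≠ F`, let `M` be the subfield of all `m` with `m A ⊆ A`;
then `A ⋊ D = (A ⋊ Mˣ) ⊓ (F ⋊ D)`, so meet irreducibility forces `D = Mˣ` and `A` meet irreducible
among `M`-subspaces, that is, a hyperplane. Conversely everything strictly above `A ⋊ Lˣ`, for an
`L`-hyperplane `A`, contains `F ⋊ Lˣ`
(`translationExtension_le_of_subfieldSubgroup_lt`). The complement `Fˣ` is the case `L = F`, `A = 0`.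

The linear part of a subgroup is a conjugation invariant, and it recovers `L` from `A ⋊ Lˣ`; all
hyperplanes over `L` are scalings of one another (`exists_units_smul_of_isCoatom`). So these classes
correspond to the subfields of `F`, which the Galois correspondence counts as the divisors of `n`,
while the classes of the `F ⋊ D` correspond to the prime power divisors of `p ^ n - 1`.
-/

/-! ### Conjugation of subgroups -/

section Conjugation

variable {G : Type*} [Group G]

theorem mem_conjSubgroup {g x : G} {K : Subgroup G} :
    x ∈ conjSubgroup g K ↔ g⁻¹ * x * g ∈ K := by
  constructor
  · rintro ⟨y, hy, rfl⟩
    simpa [mul_assoc] using hy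
  · intro h
    exact ⟨_, h, by simp [mul_assoc]⟩

theorem conjSubgroup_one (K : Subgroup G) : conjSubgroup 1 K = K := by
  ext x
  simp [mem_conjSubgroup]

theorem conjSubgroup_mul (g h : G) (K : Subgroup G) :
    conjSubgroup (g * h) K = conjSubgroup g (conjSubgroup h K) := by
  ext x
  simp [mem_conjSubgroup, mul_assoc]

theorem conjSubgroup_inv_conjSubgroup (g : G) (K : Subgroup G) :
    conjSubgroup g⁻¹ (conjSubgroup g K) = K := by
  rw [← conjSubgroup_mul, inv_mul_cancel, conjSubgroup_one]

theorem conjSubgroup_conjSubgroup_inv (g : G) (K : Subgroup G) :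
    conjSubgroup g (conjSubgroup g⁻¹ K) = K := by
  rw [← conjSubgroup_mul, mul_inv_cancel, conjSubgroup_one]

theorem conjSubgroup_lt_conjSubgroup {g : G} {K H : Subgroup G} :
    conjSubgroup g K < conjSubgroup g H ↔ K < H :=
  (MulAut.conj g).mapSubgroup.lt_iff_lt

theorem InfIrred.map_orderIso {α β : Type*} [SemilatticeInf α] [SemilatticeInf β] (e : α ≃o β)
    {a : α} (ha : InfIrred a) : InfIrred (e a) := by
  refine ⟨fun h => ha.1 ((OrderIso.isMax_apply e).1 h), fun b c hbc => ?_⟩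
  have h : e.symm b ⊓ e.symm c = a := by rw [← map_inf, hbc, e.symm_apply_apply]
  exact (ha.2 h).imp (fun h => by rw [← h, e.apply_symm_apply])
    (fun h => by rw [← h, e.apply_symm_apply])

theorem InfIrred.conjSubgroup {K : Subgroup G} (hK : InfIrred K) (g : G) :
    InfIrred (conjSubgroup g K) :=
  hK.map_orderIso (MulAut.conj g).mapSubgroup

theorem mem_subgroupConjClass_self (K : Subgroup G) : K ∈ subgroupConjClass K :=
  ⟨1, (conjSubgroup_one K).symm⟩

theorem conjSubgroup_mem_subgroupConjClass (g : G) {K M : Subgroup G}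
    (h : K ∈ subgroupConjClass M) : conjSubgroup g K ∈ subgroupConjClass M := by
  obtain ⟨k, rfl⟩ := h
  exact ⟨g * k, (conjSubgroup_mul g k M).symm⟩

theorem subgroupConjClass_eq_of_mem {K M : Subgroup G} (h : K ∈ subgroupConjClass M) :
    subgroupConjClass K = subgroupConjClass M := by
  obtain ⟨k, rfl⟩ := h
  ext N
  constructor
  · rintro ⟨g, rfl⟩
    exact ⟨g * k, (conjSubgroup_mul g k M).symm⟩
  · rintro ⟨g, rfl⟩
    exact ⟨g * k⁻¹, by rw [conjSubgroup_mul, conjSubgroup_inv_conjSubgroup]⟩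

theorem subgroupConjClass_conjSubgroup (g : G) (K : Subgroup G) :
    subgroupConjClass (conjSubgroup g K) = subgroupConjClass K :=
  subgroupConjClass_eq_of_mem ⟨g, rfl⟩

theorem InfIrred.of_mem_subgroupConjClass {K M : Subgroup G} (hM : InfIrred M)
    (h : K ∈ subgroupConjClass M) : InfIrred K := by
  obtain ⟨g, rfl⟩ := h
  exact hM.conjSubgroup g

end Conjugation

/-! ### Generating sets of the complete transfer system -/

section Generation

variable {G : Type*} [Group G]

theorem TransferClosure.le {S : Set (Subgroup G × Subgroup G)} (hS : ∀ e ∈ S, e.1 ≤ e.2)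
    {K H : Subgroup G} (h : TransferClosure S K H) : K ≤ H := by
  induction h with
  | basic h => exact hS _ h
  | refl => exact le_rfl
  | trans _ _ h₁ h₂ => exact h₁.trans h₂
  | restrict _ _ h => exact inf_le_inf_right _ h
  | conj g _ h => exact Subgroup.map_mono h

/-- The edges that do not start with a strict inclusion at a conjugate of `M` are closed under the
operations of a transfer system when `M` is meet irreducible: a restriction `K ⊓ L → H ⊓ L` that
starts at a conjugate of `M` has `K` or `L` equal to that conjugate. -/
theorem TransferClosure.not_strict {S : Set (Subgroup G × Subgroup G)} {M : Subgroup G}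
    (hM : InfIrred M) (hS : ∀ e ∈ S, e.1 ≤ e.2)
    (hSM : ∀ e ∈ S, e.1 ∈ subgroupConjClass M → ¬ e.1 < e.2)
    {K H : Subgroup G} (h : TransferClosure S K H) (hK : K ∈ subgroupConjClass M) :
    ¬ K < H := by
  induction h with
  | basic h => exact hSM _ h hK
  | refl => exact lt_irrefl _
  | @trans L K H hLK hKH h₁ h₂ =>
    intro hlt
    rcases (hLK.le hS).eq_or_lt with rfl | hlt'
    · exact h₂ hK hlt
    · exact h₁ hK hlt'
  | @restrict K H L hKH hL ih =>
    intro hlt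
    rcases (hM.of_mem_subgroupConjClass hK).2 rfl with h | h
    · rw [← h] at hK hlt
      exact ih hK (hlt.trans_le inf_le_left)
    · rw [← h] at hlt
      exact hlt.not_ge inf_le_right
  | @conj K H g hKH ih =>
    intro hlt
    refine ih ?_ (conjSubgroup_lt_conjSubgroup.1 hlt)
    simpa only [conjSubgroup_inv_conjSubgroup] using conjSubgroup_mem_subgroupConjClass g⁻¹ hK

/-- A set of inclusions generates the complete transfer system exactly when it contains a strict
inclusion out of some member of each conjugacy class of meet irreducible proper subgroups. -/
theorem generatedBy_completeTransferSystem_iff [Finite G] {S : Set (Subgroup G × Subgroup G)} :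
    (completeTransferSystem G).GeneratedBy S ↔ (∀ e ∈ S, e.1 ≤ e.2) ∧
      ∀ M : Subgroup G, InfIrred M → ∃ e ∈ S, e.1 ∈ subgroupConjClass M ∧ e.1 < e.2 := by
  constructor
  · intro h
    have hS : ∀ e ∈ S, e.1 ≤ e.2 := fun e he => (h e.1 e.2).1 (.basic he)
    refine ⟨hS, fun M hM => ?_⟩
    by_contra! hcon
    exact ((h M ⊤).2 le_top).not_strict hM hS hcon (mem_subgroupConjClass_self M)
      (lt_top_iff_ne_top.2 hM.ne_top)
  · rintro ⟨hS, hirr⟩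
    have key : ∀ K : Subgroup G, TransferClosure S K ⊤ := by
      intro K
      induction K using WellFoundedGT.induction with
      | ind K ih =>
        rcases eq_or_ne K ⊤ with rfl | hK
        · exact .refl _
        by_cases hirrK : InfIrred K
        · obtain ⟨⟨K', H⟩, he, ⟨g, rfl : K' = _⟩, hlt⟩ := hirr K hirrK
          have h₁ := TransferClosure.conj g⁻¹ (TransferClosure.basic he)
          rw [conjSubgroup_inv_conjSubgroup] at h₁
          refine h₁.trans (ih _ ?_)
          rwa [← conjSubgroup_lt_conjSubgroup (g := g), conjSubgroup_conjSubgroup_inv]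
        · rcases not_infIrred.1 hirrK with h | ⟨A, B, rfl, hA, hB⟩
          · exact absurd h.eq_top hK
          · have := (ih A hA).restrict (le_top : B ≤ ⊤)
            rw [top_inf_eq] at this
            exact this.trans (ih B hB)
    refine fun K H => ⟨fun h => h.le hS, fun h => ?_⟩
    have := (key K).restrict (le_top : H ≤ ⊤)
    rwa [top_inf_eq, inf_eq_left.2 h] at this

/-- A generating set contains a generating set with one edge for each conjugacy class of meet
irreducible proper subgroups. -/
theorem exists_generatedBy_subset_ncard_eq [Finite G] {S : Set (Subgroup G × Subgroup G)}
    (hS : (completeTransferSystem G).GeneratedBy S) :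
    ∃ T ⊆ S, (completeTransferSystem G).GeneratedBy T ∧
      T.ncard = numConjClasses {K : Subgroup G | InfIrred K} := by
  obtain ⟨hle, hirr⟩ := generatedBy_completeTransferSystem_iff.1 hS
  have hex : ∀ c : subgroupConjClass '' {K : Subgroup G | InfIrred K},
      ∃ e ∈ S, e.1 ∈ c.1 ∧ e.1 < e.2 := by
    rintro ⟨_, M, hM, rfl⟩
    exact hirr M hM
  choose e heS hec helt using hex
  refine ⟨Set.range e, Set.range_subset_iff.2 heS, generatedBy_completeTransferSystem_iff.2
    ⟨fun x ⟨c, hc⟩ => hc ▸ (helt c).le, fun M hM =>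
      ⟨_, ⟨⟨_, M, hM, rfl⟩, rfl⟩, hec ⟨_, M, hM, rfl⟩, helt _⟩⟩, ?_⟩
  have hclass : ∀ c, subgroupConjClass (e c).1 = c.1 := by
    rintro ⟨_, M, hM, rfl⟩
    exact subgroupConjClass_eq_of_mem (hec ⟨_, M, hM, rfl⟩)
  have hinj : Function.Injective e := fun c d hcd =>
    Subtype.ext (by rw [← hclass c, ← hclass d, hcd])
  rw [numConjClasses, ← Set.image_univ, Set.ncard_image_of_injective _ hinj, Set.ncard_univ,
    Nat.card_coe_set_eq]

theorem ncard_of_minimal_generatedBy [Finite G] {S : Set (Subgroup G × Subgroup G)}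
    (hS : Minimal (completeTransferSystem G).GeneratedBy S) :
    S.ncard = numConjClasses {K : Subgroup G | InfIrred K} := by
  obtain ⟨T, hTS, hT, hcard⟩ := exists_generatedBy_subset_ncard_eq hS.prop
  rw [← hcard, hTS.antisymm (hS.le_of_le hT hTS)]

theorem width_eq_numConjClasses_infIrred [Finite G] :
    width G = numConjClasses {K : Subgroup G | InfIrred K} := by
  have hall : (completeTransferSystem G).GeneratedBy {e | e.1 ≤ e.2} :=
    generatedBy_completeTransferSystem_iff.2 ⟨fun _ h => h, fun M hM =>
      ⟨(M, ⊤), le_top (a := M), mem_subgroupConjClass_self M, lt_top_iff_ne_top.2 hM.ne_top⟩⟩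
  obtain ⟨T, -, hT, hcard⟩ := exists_generatedBy_subset_ncard_eq hall
  have hmem : numConjClasses {K : Subgroup G | InfIrred K} ∈ {k | ∃ S : Finset _,
      (completeTransferSystem G).GeneratedBy (S : Set (Subgroup G × Subgroup G)) ∧ S.card = k} :=
    ⟨T.toFinite.toFinset, by simpa using hT, by rw [← hcard, Set.ncard_eq_toFinset_card]⟩
  refine le_antisymm (Nat.sInf_le hmem) (le_csInf ⟨_, hmem⟩ ?_)
  rintro _ ⟨S, hS, rfl⟩
  obtain ⟨T, hTS, -, hcard⟩ := exists_generatedBy_subset_ncard_eq hS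
  rw [← hcard, ← Set.ncard_coe_finset]
  exact Set.ncard_le_ncard hTS S.finite_toSet

end Generation

/-! ### Subgroups of finite cyclic groups -/

section Cyclic

theorem card_divisors_filter_isPrimePow (n : ℕ) (hn : n ≠ 0) :
    (n.divisors.filter IsPrimePow).card = ArithmeticFunction.cardFactors n := by
  induction n using Nat.recOnPosPrimePosCoprime with
  | zero => exact absurd rfl hn
  | one => simp [Finset.filter_singleton, not_isPrimePow_one]
  | prime_pow q k hq hk =>
    have : (q ^ k).divisors.filter IsPrimePow = (Finset.Icc 1 k).image (q ^ ·) := by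
      ext d
      simp only [Finset.mem_filter, Nat.mem_divisors_prime_pow hq, Finset.mem_image,
        Finset.mem_Icc]
      constructor
      · rintro ⟨⟨j, hj, rfl⟩, hd⟩
        refine ⟨j, ⟨Nat.one_le_iff_ne_zero.2 ?_, hj⟩, rfl⟩
        rintro rfl
        exact not_isPrimePow_one (by simpa using hd)
      · rintro ⟨j, ⟨hj, hjk⟩, rfl⟩
        exact ⟨⟨j, hjk, rfl⟩, hq.isPrimePow.pow (by lia)⟩
    rw [this, Finset.card_image_of_injective _ (Nat.pow_right_injective hq.two_le),
      ArithmeticFunction.cardFactors_apply_prime_pow hq]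
    simp
  | coprime a b ha hb hab iha ihb =>
    rw [Nat.mul_divisors_filter_prime_pow hab, Finset.filter_union,
      Finset.card_union_of_disjoint (Nat.disjoint_divisors_filter_isPrimePow hab),
      iha (by lia), ihb (by lia), ArithmeticFunction.cardFactors_mul (by lia) (by lia)]

variable {C : Type*} [CommGroup C] [IsCyclic C] [Finite C]

theorem index_range_powMonoidHom_of_dvd {d : ℕ} (hd : d ∣ Nat.card C) :
    (powMonoidHom d : C →* C).range.index = d := by
  rw [IsCyclic.index_powMonoidHom_range, Nat.gcd_eq_right hd]

/-- The only subgroup of index `d` in a finite cyclic group is the subgroup of `d`-th powers. -/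
theorem range_powMonoidHom_index (D : Subgroup C) :
    (powMonoidHom D.index : C →* C).range = D := by
  have hle : (powMonoidHom D.index : C →* C).range ≤ D := by
    rintro _ ⟨x, rfl⟩
    exact D.pow_index_mem x
  refine le_antisymm hle (Subgroup.relIndex_eq_one.1 ?_)
  have h := Subgroup.relIndex_mul_index hle
  rw [index_range_powMonoidHom_of_dvd D.index_dvd_card] at h
  exact Nat.eq_of_mul_eq_mul_right (Nat.pos_of_ne_zero Subgroup.index_ne_zero_of_finite)
    (h.trans (one_mul _).symm)

theorem subgroup_index_injective : Function.Injective (Subgroup.index : Subgroup C → ℕ) :=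
  fun D E h => by rw [← range_powMonoidHom_index D, h, range_powMonoidHom_index]

theorem le_of_index_dvd_index {D E : Subgroup C} (h : E.index ∣ D.index) : D ≤ E := by
  obtain ⟨k, hk⟩ := h
  rw [← range_powMonoidHom_index D, ← range_powMonoidHom_index E, hk]
  rintro _ ⟨x, rfl⟩
  exact ⟨x ^ k, by simp [← pow_mul, mul_comm]⟩

theorem ncard_subgroup_index_mem (P : ℕ → Prop) [DecidablePred P] :
    {D : Subgroup C | P D.index}.ncard = ((Nat.card C).divisors.filter P).card := by
  rw [← Set.ncard_image_of_injective _ subgroup_index_injective, ← Set.ncard_coe_finset]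
  congr 1
  ext d
  simp only [Set.mem_image, Set.mem_ofPred_eq, Finset.coe_filter, Nat.mem_divisors]
  constructor
  · rintro ⟨D, hD, rfl⟩
    exact ⟨⟨D.index_dvd_card, Nat.card_pos.ne'⟩, hD⟩
  · rintro ⟨⟨hd, -⟩, hP⟩
    exact ⟨_, by rwa [index_range_powMonoidHom_of_dvd hd], index_range_powMonoidHom_of_dvd hd⟩

theorem card_subgroup_of_isCyclic : Nat.card (Subgroup C) = (Nat.card C).divisors.card := by
  have := ncard_subgroup_index_mem (C := C) (fun _ => True)
  simpa [Set.ncard_univ] using this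

/-- The subgroups of a finite cyclic group are ordered by divisibility of the index, so a subgroup
is meet irreducible exactly when its index is not the least common multiple of two proper
divisors. -/
theorem infIrred_iff_isPrimePow_index {D : Subgroup C} : InfIrred D ↔ IsPrimePow D.index := by
  constructor
  · intro hD
    have h1 : D.index ≠ 1 := fun h => hD.ne_top (Subgroup.index_eq_one.1 h)
    obtain ⟨q, hq, hqd⟩ := Nat.exists_prime_and_dvd h1
    obtain ⟨k, c, hc, hk⟩ := Nat.exists_eq_pow_mul_and_not_dvd
      (Subgroup.index_ne_zero_of_finite (H := D)) q hq.ne_one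
    have hk0 : k ≠ 0 := by
      rintro rfl
      exact hc (by simpa [hk] using hqd)
    have hqk : q ^ k ∣ Nat.card C := (Dvd.intro _ hk.symm).trans D.index_dvd_card
    have hcC : c ∣ Nat.card C := (Dvd.intro_left _ hk.symm).trans D.index_dvd_card
    have hinf : (powMonoidHom (q ^ k) : C →* C).range ⊓ (powMonoidHom c : C →* C).range = D := by
      refine le_antisymm (le_of_index_dvd_index ?_) (le_inf (le_of_index_dvd_index ?_)
        (le_of_index_dvd_index ?_))
      · rw [hk]
        refine Nat.Coprime.mul_dvd_of_dvd_of_dvd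
          (Nat.Coprime.pow_left _ ((Nat.Prime.coprime_iff_not_dvd hq).2 hc)) ?_ ?_
        · conv_lhs => rw [← index_range_powMonoidHom_of_dvd hqk]
          exact Subgroup.index_dvd_of_le inf_le_left
        · conv_lhs => rw [← index_range_powMonoidHom_of_dvd hcC]
          exact Subgroup.index_dvd_of_le inf_le_right
      · rw [index_range_powMonoidHom_of_dvd hqk]
        exact Dvd.intro _ hk.symm
      · rw [index_range_powMonoidHom_of_dvd hcC]
        exact Dvd.intro_left _ hk.symm
    rcases hD.2 hinf with h | h
    · rw [← h, index_range_powMonoidHom_of_dvd hqk]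
      exact hq.isPrimePow.pow hk0
    · exact absurd (by rwa [← h, index_range_powMonoidHom_of_dvd hcC] at hqd) hc
  · intro hD
    obtain ⟨q, k, hq, hk, hqk⟩ := (isPrimePow_nat_iff _).1 hD
    refine ⟨fun h => ?_, fun A B hAB => ?_⟩
    · rw [h.eq_top, Subgroup.index_top] at hD
      exact not_isPrimePow_one hD
    · obtain ⟨a, -, ha⟩ := (Nat.dvd_prime_pow hq).1
        (hqk ▸ Subgroup.index_dvd_of_le (hAB ▸ inf_le_left : D ≤ A))
      obtain ⟨b, -, hb⟩ := (Nat.dvd_prime_pow hq).1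
        (hqk ▸ Subgroup.index_dvd_of_le (hAB ▸ inf_le_right : D ≤ B))
      rcases le_total a b with h | h
      · have : B ≤ A := le_of_index_dvd_index (by rw [ha, hb]; exact pow_dvd_pow q h)
        exact .inr (by rw [← hAB, inf_eq_right.2 this])
      · have : A ≤ B := le_of_index_dvd_index (by rw [ha, hb]; exact pow_dvd_pow q h)
        exact .inl (by rw [← hAB, inf_eq_left.2 this])

end Cyclic

/-- Meet irreducibility is unchanged by pulling back along a surjective homomorphism, because every
subgroup above a preimage is a preimage. -/
theorem infIrred_comap_iff {G H : Type*} [Group G] [Group H] {f : G →* H}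
    (hf : Function.Surjective f) {D : Subgroup H} : InfIrred (D.comap f) ↔ InfIrred D := by
  have hinj := Subgroup.comap_injective hf
  constructor
  · refine fun h => ⟨fun hD => h.ne_top (by rw [hD.eq_top, Subgroup.comap_top]), fun A B hAB => ?_⟩
    have hinf : A.comap f ⊓ B.comap f = D.comap f := by rw [← Subgroup.comap_inf, hAB]
    exact (h.2 hinf).imp (fun h => hinj h) (fun h => hinj h)
  · refine fun h => ⟨fun hD => h.ne_top (hinj (by rw [hD.eq_top, Subgroup.comap_top])),
      fun A B hAB => ?_⟩
    have hker : f.ker ≤ D.comap f := by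
      rw [← MonoidHom.comap_bot]
      exact Subgroup.comap_mono bot_le
    have hA : (A.map f).comap f = A :=
      Subgroup.comap_map_eq_self (hker.trans (hAB ▸ inf_le_left))
    have hB : (B.map f).comap f = B :=
      Subgroup.comap_map_eq_self (hker.trans (hAB ▸ inf_le_right))
    have hinf : A.map f ⊓ B.map f = D := hinj (by rw [Subgroup.comap_inf, hA, hB, hAB])
    exact (h.2 hinf).imp (fun h => by rw [← h, hA]) (fun h => by rw [← h, hB])

/-! ### Hyperplanes over subfields -/

section Hyperplanes

/-- In a complemented modular lattice, a meet irreducible element is a coatom: if `b < c`, then a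
relative complement `d` of `c` above `b` satisfies `c ⊓ d = b`. -/
theorem InfIrred.isCoatom {α : Type*} [Lattice α] [BoundedOrder α] [IsModularLattice α]
    [ComplementedLattice α] {b : α} (hb : InfIrred b) : IsCoatom b := by
  refine ⟨hb.ne_top, fun c hbc => ?_⟩
  obtain ⟨d, hd⟩ := exists_isCompl c
  have hinf : c ⊓ (b ⊔ d) = b := by
    rw [inf_comm, sup_inf_assoc_of_le _ hbc.le, inf_comm d c, hd.inf_eq_bot, sup_bot_eq]
  rcases hb.2 hinf with h | h
  · exact absurd h hbc.ne'
  · rw [← hd.sup_eq_top, eq_comm, sup_eq_left]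
    exact (le_sup_right.trans h.le).trans hbc.le

theorem Submodule.finrank_add_one_eq_iff_isCoatom {K V : Type*} [Field K] [AddCommGroup V]
    [Module K V] [FiniteDimensional K V] {A : Submodule K V} :
    Module.finrank K A + 1 = Module.finrank K V ↔ IsCoatom A := by
  rw [← isSimpleModule_iff_isCoatom, isSimpleModule_iff_finrank_eq_one,
    ← A.finrank_quotient_add_finrank]
  lia

theorem Submodule.exists_ker_eq_of_isCoatom {K V : Type*} [Field K] [AddCommGroup V] [Module K V]
    {A : Submodule K V} (hA : IsCoatom A) : ∃ f : V →ₗ[K] K, f ≠ 0 ∧ LinearMap.ker f = A := by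
  obtain ⟨f, hf, hle⟩ := A.exists_le_ker_of_lt_top (lt_top_iff_ne_top.2 hA.1)
  exact ⟨f, hf, (hA.le_iff_eq (mt LinearMap.ker_eq_top.1 hf)).1 hle⟩

/-- For a nonzero functional `f` on a finite extension field, every functional has the form
`x ↦ f (c * x)`; hence any two hyperplanes differ by a scaling. -/
theorem exists_units_smul_of_isCoatom {K E : Type*} [Field K] [Field E] [Algebra K E]
    [FiniteDimensional K E] {A B : Submodule K E} (hA : IsCoatom A) (hB : IsCoatom B) :
    ∃ c : Eˣ, ∀ x, x ∈ B ↔ (c : E) * x ∈ A := by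
  obtain ⟨f, hf, rfl⟩ := Submodule.exists_ker_eq_of_isCoatom hA
  obtain ⟨g, hg, rfl⟩ := Submodule.exists_ker_eq_of_isCoatom hB
  let T : E →ₗ[K] Module.Dual K E := (LinearMap.compRight K f).comp (LinearMap.mul K E)
  have hT : ∀ c x, T c x = f (c * x) := fun c x => rfl
  have hinj : Function.Injective T := by
    rw [injective_iff_map_eq_zero]
    intro c hc
    by_contra hc0
    refine hf (LinearMap.ext fun x => ?_)
    have := LinearMap.congr_fun hc (c⁻¹ * x)
    rwa [hT, mul_inv_cancel_left₀ hc0] at this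
  obtain ⟨c, rfl⟩ := (LinearMap.injective_iff_surjective_of_finrank_eq_finrank
    (Subspace.dual_finrank_eq (K := K) (V := E)).symm).1 hinj g
  have hc0 : c ≠ 0 := by
    rintro rfl
    exact hg (map_zero T)
  exact ⟨Units.mk0 c hc0, fun x => Iff.rfl⟩

/-- Multiplication by an element that preserves a hyperplane acts on the one-dimensional quotient
as a scalar `l`, and then `d - l` maps the whole field into the hyperplane. -/
theorem mem_subfield_of_mul_mem_hyperplane {F : Type*} [Field F] {L : Subfield F}
    {A : Submodule L F} (hA : IsCoatom A) {d : F} (hd : ∀ a ∈ A, d * a ∈ A) : d ∈ L := by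
  obtain ⟨x, -, hx⟩ := SetLike.exists_of_lt (lt_top_iff_ne_top.2 hA.1)
  have hsup : A ⊔ Submodule.span L {x} = ⊤ := by
    refine hA.2 _ (left_lt_sup.2 fun h => hx ?_)
    exact h (Submodule.mem_span_singleton_self x)
  have hdec : ∀ y : F, ∃ a ∈ A, ∃ l : L, a + (l : F) * x = y := by
    intro y
    have hy : y ∈ A ⊔ Submodule.span L {x} := hsup ▸ Submodule.mem_top
    obtain ⟨a, ha, z, hz, rfl⟩ := Submodule.mem_sup.1 hy
    obtain ⟨l, rfl⟩ := Submodule.mem_span_singleton.1 hz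
    exact ⟨a, ha, l, rfl⟩
  obtain ⟨a, ha, l, hl⟩ := hdec (d * x)
  by_cases hdl : d - l = 0
  · rw [sub_eq_zero.1 hdl]
    exact l.2
  · refine absurd ?_ hx
    obtain ⟨b, hb, m, hm⟩ := hdec ((d - l)⁻¹ * x)
    have key : x = (d * b - (l : F) * b) + (m : F) * a := by
      have h1 : x = (d - l) * (b + m * x) := by rw [hm, mul_inv_cancel_left₀ hdl]
      linear_combination h1 - (m : F) * hl
    rw [key]
    exact A.add_mem (A.sub_mem (hd b hb) (A.smul_mem l hb)) (A.smul_mem m ha)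

/-- The subfield of a finite field that consists of the elements which map an additive subgroup `A`
into itself. -/
def stabilizerSubfield {F : Type*} [Field F] [Finite F] (A : AddSubgroup F) : Subfield F where
  carrier := {m | ∀ a ∈ A, m * a ∈ A}
  mul_mem' := fun {x y} hx hy a ha => by rw [mul_assoc]; exact hx _ (hy a ha)
  one_mem' := fun a ha => by rwa [one_mul]
  add_mem' := fun {x y} hx hy a ha => by rw [add_mul]; exact A.add_mem (hx a ha) (hy a ha)
  zero_mem' := fun a _ => by rw [zero_mul]; exact A.zero_mem
  neg_mem' := fun {x} hx a ha => by rw [neg_mul]; exact A.neg_mem (hx a ha)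
  inv_mem' := fun x hx a ha => by
    -- Multiplication by `x` is injective, hence surjective, on the finite set `A`.
    rcases eq_or_ne x 0 with rfl | hx0
    · rw [inv_zero, zero_mul]
      exact A.zero_mem
    have hinj : Function.Injective (fun b : A => (⟨x * b, hx b b.2⟩ : A)) := fun b c h =>
      Subtype.ext (mul_left_cancel₀ hx0 (congrArg Subtype.val h))
    obtain ⟨b, hb⟩ := Finite.surjective_of_injective hinj ⟨a, ha⟩
    have hb' : x * b = a := congrArg Subtype.val hb
    rw [← hb', inv_mul_cancel_left₀ hx0]
    exact b.2

/-- An additive subgroup of a finite field as a subspace over its stabilizer. -/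
def stabilizerSubmodule {F : Type*} [Field F] [Finite F] (A : AddSubgroup F) :
    Submodule (stabilizerSubfield A) F where
  __ := A
  smul_mem' m a ha := m.2 a ha

/-- Subfields of a field with `p ^ n` elements correspond to subgroups of the cyclic Galois group
of order `n` over the prime field. -/
theorem card_subfield {p n : ℕ} (hp : p.Prime) {F : Type*} [Field F]
    (hF : Nat.card F = p ^ n) : Nat.card (Subfield F) = n.divisors.card := by
  have : Fact p.Prime := ⟨hp⟩
  have : Finite F := Nat.finite_of_card_ne_zero (hF ▸ pow_ne_zero n hp.ne_zero)
  have : CharP F p := by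
    have := Fintype.ofFinite F
    exact charP_of_card_eq_prime_pow (f := n) (by rw [← Nat.card_eq_fintype_card, hF])
  let : Algebra (ZMod p) F := ZMod.algebra F p
  have hn : Module.finrank (ZMod p) F = n :=
    Nat.pow_right_injective hp.two_le (by
      simpa only [hF] using FiniteField.pow_finrank_eq_natCard p F)
  have hbij : Function.Bijective
      (IntermediateField.toSubfield : IntermediateField (ZMod p) F → Subfield F) := by
    refine ⟨IntermediateField.toSubfield_injective,
      fun L => ⟨L.toIntermediateField fun x => ?_, rfl⟩⟩
    rw [← ZMod.natCast_zmod_val x, map_natCast]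
    exact natCast_mem L _
  let : CommGroup Gal(F/ZMod p) := IsCyclic.commGroup
  rw [← Nat.card_congr (Equiv.ofBijective _ hbij),
    Nat.card_congr (IsGalois.intermediateFieldEquivSubgroup (F := ZMod p) (E := F)).toEquiv]
  have h := card_subgroup_of_isCyclic (C := Gal(F/ZMod p))
  rw [IsGalois.card_aut_eq_finrank, hn] at h
  exact h

end Hyperplanes

/-! ### Subgroups of the affine group -/

section Affine

variable {F : Type*} [Field F]

/-- The translation `x ↦ x + v`. -/
def translation (v : F) : AGL1 F := SemidirectProduct.inl (Multiplicative.ofAdd v)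

/-- The scaling `x ↦ u * x`. -/
def scaling (u : Fˣ) : AGL1 F := SemidirectProduct.inr u

theorem translation_mul_scaling (g : AGL1 F) :
    translation (Multiplicative.toAdd g.left) * scaling g.right = g :=
  SemidirectProduct.inl_left_mul_inr_right g

/-- The translation vectors of a subgroup of the affine group. -/
def translationPart (K : Subgroup (AGL1 F)) : AddSubgroup F where
  carrier := {v | translation v ∈ K}
  zero_mem' := K.one_mem
  add_mem' := fun {a b} ha hb => by
    have h : translation (a + b) = translation a * translation b := map_mul _ _ _
    rw [Set.mem_ofPred_eq, h]
    exact K.mul_mem ha hb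
  neg_mem' := fun {a} ha => by
    have h : translation (-a) = (translation a)⁻¹ := map_inv _ _
    rw [Set.mem_ofPred_eq, h]
    exact K.inv_mem ha

/-- The linear coefficients of the elements of a subgroup of the affine group. -/
def linearPart (K : Subgroup (AGL1 F)) : Subgroup Fˣ :=
  K.map SemidirectProduct.rightHom

theorem mem_translationPart {K : Subgroup (AGL1 F)} {v : F} :
    v ∈ translationPart K ↔ translation v ∈ K := Iff.rfl

theorem right_mem_linearPart {K : Subgroup (AGL1 F)} {g : AGL1 F} (hg : g ∈ K) :
    g.right ∈ linearPart K := ⟨g, hg, rfl⟩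

theorem conj_translation (g : AGL1 F) (v : F) :
    g * translation v * g⁻¹ = translation ((g.right : F) * v) := by
  rw [mul_inv_eq_iff_eq_mul]
  refine SemidirectProduct.ext ?_ ?_
  · apply Multiplicative.toAdd.injective
    simp [translation, affineAction_apply, add_comm]
  · simp [translation]

theorem linearPart_mul_mem_translationPart {K : Subgroup (AGL1 F)} {d : Fˣ}
    (hd : d ∈ linearPart K) {a : F} (ha : a ∈ translationPart K) :
    (d : F) * a ∈ translationPart K := by
  obtain ⟨g, hg, rfl⟩ := hd
  rw [mem_translationPart]
  have := K.mul_mem (K.mul_mem hg ha) (K.inv_mem hg)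
  rwa [conj_translation] at this

theorem mem_semidirectSubgroup {A : AddSubgroup F} {D : Subgroup Fˣ}
    {h : ∀ d ∈ D, ∀ a ∈ A, (d : F) * a ∈ A} {g : AGL1 F} :
    g ∈ semidirectSubgroup A D h ↔ Multiplicative.toAdd g.left ∈ A ∧ g.right ∈ D := Iff.rfl

theorem translationPart_semidirectSubgroup {A : AddSubgroup F} {D : Subgroup Fˣ}
    {h : ∀ d ∈ D, ∀ a ∈ A, (d : F) * a ∈ A} :
    translationPart (semidirectSubgroup A D h) = A := by
  ext v
  exact ⟨fun hv => hv.1, fun hv => ⟨hv, D.one_mem⟩⟩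

theorem scaling_mem_semidirectSubgroup {A : AddSubgroup F} {D : Subgroup Fˣ}
    {h : ∀ d ∈ D, ∀ a ∈ A, (d : F) * a ∈ A} {d : Fˣ} (hd : d ∈ D) :
    scaling d ∈ semidirectSubgroup A D h := ⟨A.zero_mem, hd⟩

theorem linearPart_semidirectSubgroup {A : AddSubgroup F} {D : Subgroup Fˣ}
    {h : ∀ d ∈ D, ∀ a ∈ A, (d : F) * a ∈ A} :
    linearPart (semidirectSubgroup A D h) = D := by
  ext d
  constructor
  · rintro ⟨g, hg, rfl⟩
    exact hg.2
  · exact fun hd => ⟨scaling d, scaling_mem_semidirectSubgroup hd, rfl⟩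

theorem eq_semidirectSubgroup_of_scaling_mem {K : Subgroup (AGL1 F)}
    (hK : ∀ d ∈ linearPart K, scaling d ∈ K) :
    K = semidirectSubgroup (translationPart K) (linearPart K)
      (fun _ hd _ ha => linearPart_mul_mem_translationPart hd ha) := by
  ext g
  rw [mem_semidirectSubgroup, mem_translationPart]
  constructor
  · intro hg
    have hr := right_mem_linearPart hg
    refine ⟨?_, hr⟩
    rwa [← K.mul_mem_cancel_right (hK _ hr), translation_mul_scaling]
  · rintro ⟨hl, hr⟩
    rw [← translation_mul_scaling g]
    exact K.mul_mem hl (hK _ hr)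

theorem linearPart_conjSubgroup (g : AGL1 F) (K : Subgroup (AGL1 F)) :
    linearPart (conjSubgroup g K) = linearPart K := by
  ext d
  constructor
  · rintro ⟨_, ⟨k, hk, rfl⟩, rfl⟩
    exact ⟨k, hk, by simp⟩
  · rintro ⟨k, hk, rfl⟩
    exact ⟨_, ⟨k, hk, rfl⟩, by simp⟩

theorem linearPart_eq_of_subgroupConjClass_eq {K M : Subgroup (AGL1 F)}
    (h : subgroupConjClass K = subgroupConjClass M) : linearPart K = linearPart M := by
  obtain ⟨g, rfl⟩ := h ▸ mem_subgroupConjClass_self K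
  exact linearPart_conjSubgroup g M

theorem translationPart_conjSubgroup (g : AGL1 F) (K : Subgroup (AGL1 F)) {v : F} :
    v ∈ translationPart (conjSubgroup g K) ↔ ((g.right⁻¹ : Fˣ) : F) * v ∈ translationPart K := by
  have h := conj_translation g⁻¹ v
  rw [inv_inv] at h
  rw [mem_translationPart, mem_conjSubgroup, h, mem_translationPart, SemidirectProduct.inv_right]

/-- Over a finite field the linear part is cyclic. An element of the subgroup that maps to a
generator `u ≠ 1` of it fixes the point `w / (1 - u)`; conjugation by a translation moves this
fixed point to `0`, and leaves the translation part unchanged. -/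
theorem exists_conjSubgroup_eq_semidirectSubgroup [Finite F] (K : Subgroup (AGL1 F)) :
    ∃ g, conjSubgroup g K = semidirectSubgroup (translationPart K) (linearPart K)
      (fun _ hd _ ha => linearPart_mul_mem_translationPart hd ha) := by
  suffices h : ∃ v : F, ∀ d ∈ linearPart K, scaling d ∈ conjSubgroup (translation v) K by
    obtain ⟨v, hv⟩ := h
    refine ⟨translation v, ?_⟩
    have hl := linearPart_conjSubgroup (translation v) K
    have ht : translationPart (conjSubgroup (translation v) K) = translationPart K := by
      ext w
      rw [translationPart_conjSubgroup]
      simp [translation]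
    rw [eq_semidirectSubgroup_of_scaling_mem (K := conjSubgroup (translation v) K)
      (by rwa [hl])]
    ext g
    rw [mem_semidirectSubgroup, mem_semidirectSubgroup, hl, ht]
  suffices h : ∀ u ∈ linearPart K, ∃ v : F, scaling u ∈ conjSubgroup (translation v) K by
    obtain ⟨u, hu⟩ := (Subgroup.isCyclic_iff_exists_zpowers_eq_top (linearPart K)).1 inferInstance
    obtain ⟨v, hv⟩ := h u (hu ▸ Subgroup.mem_zpowers u)
    have hle : linearPart K ≤ (conjSubgroup (translation v) K).comap SemidirectProduct.inr := by
      rw [← hu, Subgroup.zpowers_le]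
      exact hv
    exact ⟨v, hle⟩
  rintro _ ⟨k, hk, rfl⟩
  rw [SemidirectProduct.rightHom_eq_right]
  rcases eq_or_ne k.right 1 with h1 | h1
  · refine ⟨0, ?_⟩
    rw [h1]
    exact Subgroup.one_mem _
  · set w := Multiplicative.toAdd k.left with hw
    have hu : (1 : F) - (k.right : F) ≠ 0 := fun h =>
      h1 (Units.ext (by simpa using (sub_eq_zero.1 h).symm))
    set x := w / (1 - (k.right : F)) with hx
    have hfix : w + (k.right : F) * x = x := by
      rw [hx]
      field_simp
      ring
    refine ⟨-x, mem_conjSubgroup.2 ?_⟩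
    have : (translation (-x))⁻¹ * scaling k.right * translation (-x) = k := by
      rw [mul_assoc, inv_mul_eq_iff_eq_mul]
      refine SemidirectProduct.ext ?_ ?_
      · apply Multiplicative.toAdd.injective
        simp only [translation, scaling, SemidirectProduct.mul_left, SemidirectProduct.left_inl,
          SemidirectProduct.right_inl, SemidirectProduct.left_inr, SemidirectProduct.right_inr,
          toAdd_mul, affineAction_apply, toAdd_ofAdd, toAdd_one, map_one, MulAut.one_apply]
        linear_combination -hfix
      · simp [translation, scaling]
    rwa [this]

theorem translationExtension_eq_comap (D : Subgroup Fˣ) :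
    translationExtension D = D.comap (SemidirectProduct.rightHom (φ := affineAction F)) := by
  ext g
  exact ⟨fun h => h.2, fun h => ⟨AddSubgroup.mem_top _, h⟩⟩

theorem infIrred_translationExtension_iff [Finite F] {D : Subgroup Fˣ} :
    InfIrred (translationExtension D) ↔ IsPrimePow D.index := by
  rw [translationExtension_eq_comap, infIrred_comap_iff SemidirectProduct.rightHom_surjective,
    infIrred_iff_isPrimePow_index]

theorem conjSubgroup_translationExtension (g : AGL1 F) (D : Subgroup Fˣ) :
    conjSubgroup g (translationExtension D) = translationExtension D := by
  ext x
  simp [mem_conjSubgroup, translationExtension_eq_comap, mul_comm]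

theorem mem_units_subfield {L : Subfield F} {u : Fˣ} :
    u ∈ L.toSubmonoid.units ↔ (u : F) ∈ L :=
  ⟨fun h => h.1, fun h => ⟨h, by simpa using L.inv_mem h⟩⟩

theorem subfield_units_injective :
    Function.Injective (fun L : Subfield F => L.toSubmonoid.units) := by
  intro L M h
  ext x
  rcases eq_or_ne x 0 with rfl | hx
  · simp
  · have := SetLike.ext_iff.1 h (Units.mk0 x hx)
    rwa [mem_units_subfield, mem_units_subfield] at this

theorem isCoatom_iff_eq_bot_of_top {A : Submodule (⊤ : Subfield F) F} :
    IsCoatom A ↔ A = ⊥ := by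
  have key : ∀ B : Submodule (⊤ : Subfield F) F, B ≠ ⊥ → B = ⊤ := by
    intro B hB
    obtain ⟨b, hb, hb0⟩ := B.exists_mem_ne_zero_of_ne_bot hB
    refine Submodule.eq_top_iff'.2 fun x => ?_
    have := B.smul_mem (⟨x / b, Subfield.mem_top _⟩ : (⊤ : Subfield F)) hb
    rwa [Subfield.smul_def, smul_eq_mul, div_mul_cancel₀ x hb0] at this
  constructor
  · intro hA
    by_contra h
    exact hA.1 (key A h)
  · rintro rfl
    exact ⟨bot_ne_top, fun B hB => key B hB.ne'⟩

theorem subfieldSubgroup_top_bot :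
    subfieldSubgroup (⊤ : Subfield F) ⊥ = pointStabilizer F := by
  ext g
  refine ⟨fun h => ⟨h.1, Subgroup.mem_top _⟩, fun h => ⟨h.1, ?_⟩⟩
  exact mem_units_subfield.2 (Subfield.mem_top _)

/-- A subgroup strictly above `A ⋊ Lˣ`, for an `L`-hyperplane `A`, contains `V ⋊ Lˣ`: its
translation part is an `L`-subspace, and if that is `A`, then the linear part preserves `A` and lies
in `Lˣ`. -/
theorem translationExtension_le_of_subfieldSubgroup_lt {L : Subfield F} {A : Submodule L F}
    (hA : IsCoatom A) {K : Subgroup (AGL1 F)} (hK : subfieldSubgroup L A < K) :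
    translationExtension L.toSubmonoid.units ≤ K := by
  have hs : ∀ u : Fˣ, (u : F) ∈ L → scaling u ∈ K := fun u hu =>
    hK.le (scaling_mem_semidirectSubgroup (mem_units_subfield.2 hu))
  let B : Submodule L F :=
    { translationPart K with
      smul_mem' := fun l a ha => by
        rcases eq_or_ne (l : F) 0 with h0 | h0
        · have : l • a = 0 := by rw [Subfield.smul_def, h0, zero_smul]
          rw [this]
          exact (translationPart K).zero_mem
        · exact linearPart_mul_mem_translationPart
            (right_mem_linearPart (hs (Units.mk0 _ h0) l.2)) ha }
  have hAB : A ≤ B := fun a ha => hK.le ⟨ha, Subgroup.one_mem _⟩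
  rcases hAB.eq_or_lt with hAB | hAB
  · refine absurd (fun g hg => ?_) hK.not_ge
    have hr : (g.right : F) ∈ L := by
      refine mem_subfield_of_mul_mem_hyperplane hA fun a ha => ?_
      rw [hAB] at ha ⊢
      exact linearPart_mul_mem_translationPart (right_mem_linearPart hg) ha
    refine ⟨?_, mem_units_subfield.2 hr⟩
    change _ ∈ A
    rw [hAB]
    change translation _ ∈ K
    rwa [← K.mul_mem_cancel_right (hs _ hr), translation_mul_scaling]
  · intro g hg
    have hl : Multiplicative.toAdd g.left ∈ B := hA.2 B hAB ▸ Submodule.mem_top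
    rw [← translation_mul_scaling g]
    exact K.mul_mem hl (hs _ (mem_units_subfield.1 hg.2))

theorem infIrred_subfieldSubgroup {L : Subfield F} {A : Submodule L F} (hA : IsCoatom A) :
    InfIrred (subfieldSubgroup L A) := by
  have hnot : ¬ translationExtension L.toSubmonoid.units ≤ subfieldSubgroup L A := fun h =>
    hA.1 (Submodule.eq_top_iff'.2 fun x =>
      (h (show translation x ∈ _ from ⟨AddSubgroup.mem_top _, Subgroup.one_mem _⟩)).1)
  refine ⟨fun h => hnot (h.eq_top ▸ le_top), fun K M hKM => ?_⟩
  by_contra! hne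
  refine hnot (hKM ▸ le_inf ?_ ?_)
  · exact translationExtension_le_of_subfieldSubgroup_lt hA
      (lt_of_le_of_ne (hKM ▸ inf_le_left) hne.1.symm)
  · exact translationExtension_le_of_subfieldSubgroup_lt hA
      (lt_of_le_of_ne (hKM ▸ inf_le_right) hne.2.symm)

theorem isCoatom_of_infIrred_subfieldSubgroup {L : Subfield F} {A : Submodule L F}
    (hA : A ≠ ⊤) (h : InfIrred (subfieldSubgroup L A)) : IsCoatom A := by
  have hinj : ∀ B C : Submodule L F, subfieldSubgroup L B = subfieldSubgroup L C → B = C := by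
    intro B C hBC
    have := congrArg translationPart hBC
    rw [subfieldSubgroup, subfieldSubgroup, translationPart_semidirectSubgroup,
      translationPart_semidirectSubgroup] at this
    exact Submodule.toAddSubgroup_injective this
  refine InfIrred.isCoatom ⟨fun hmax => hA hmax.eq_top, fun B C hBC => ?_⟩
  have hinf : subfieldSubgroup L B ⊓ subfieldSubgroup L C = subfieldSubgroup L A := by
    ext g
    rw [← hBC]
    exact ⟨fun h => ⟨⟨h.1.1, h.2.1⟩, h.1.2⟩, fun h => ⟨⟨h.1.1, h.2⟩, ⟨h.1.2, h.2⟩⟩⟩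
  exact (h.2 hinf).imp (hinj _ _) (hinj _ _)

/-- Up to conjugation a subgroup is `A ⋊ D`. If `A` is everything, then it is a preimage of `D`.
Otherwise `A ⋊ D` is the intersection of `V ⋊ D` and `A ⋊ Mˣ`, where `M` is the subfield that
stabilizes `A`, so a meet irreducible subgroup has `D = Mˣ`, and `A` is meet irreducible among
`M`-subspaces. -/
theorem infIrred_iff_translationExtension_or_subfieldSubgroup [Finite F]
    {K : Subgroup (AGL1 F)} : InfIrred K ↔
      (∃ D : Subgroup Fˣ, IsPrimePow D.index ∧ K = translationExtension D) ∨
      ∃ (L : Subfield F) (A : Submodule L F) (g : AGL1 F),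
        IsCoatom A ∧ K = conjSubgroup g (subfieldSubgroup L A) := by
  constructor
  · intro hK
    obtain ⟨g, hg⟩ := exists_conjSubgroup_eq_semidirectSubgroup K
    have hirr := hK.conjSubgroup g
    set A := translationPart K
    set D := linearPart K
    have hstab : ∀ d ∈ D, ∀ a ∈ A, (d : F) * a ∈ A := fun _ hd _ ha =>
      linearPart_mul_mem_translationPart hd ha
    have hKg : K = conjSubgroup g⁻¹ (semidirectSubgroup A D hstab) := by
      rw [← hg, conjSubgroup_inv_conjSubgroup]
    rw [hg] at hirr
    by_cases hA : A = ⊤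
    · left
      have hD : semidirectSubgroup A D hstab = translationExtension D := by
        ext x
        rw [translationExtension, mem_semidirectSubgroup, mem_semidirectSubgroup, hA]
      rw [hD] at hirr hKg
      rw [conjSubgroup_translationExtension] at hKg
      exact ⟨D, infIrred_translationExtension_iff.1 hirr, hKg⟩
    · right
      have hinf : translationExtension D ⊓ subfieldSubgroup _ (stabilizerSubmodule A) =
          semidirectSubgroup A D hstab := by
        ext x
        exact ⟨fun h => ⟨h.2.1, h.1.2⟩, fun h => ⟨⟨AddSubgroup.mem_top _, h.2⟩, h.1,
          mem_units_subfield.2 (hstab _ h.2)⟩⟩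
      rcases hirr.2 hinf with h | h
      · refine absurd ?_ hA
        have := congrArg translationPart h
        rwa [translationExtension, translationPart_semidirectSubgroup,
          translationPart_semidirectSubgroup, eq_comm] at this
      · rw [← h] at hirr hKg
        refine ⟨_, _, g⁻¹, isCoatom_of_infIrred_subfieldSubgroup (fun htop => hA ?_) hirr, hKg⟩
        exact congrArg Submodule.toAddSubgroup htop
  · rintro (⟨D, hD, rfl⟩ | ⟨L, A, g, hA, rfl⟩)
    · exact infIrred_translationExtension_iff.2 hD
    · exact (infIrred_subfieldSubgroup hA).conjSubgroup g

/-- The subfield `L = F` has the single hyperplane `0`, which gives the conjugates of the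
complement. -/
theorem setOf_infIrred_eq [Finite F] : {K : Subgroup (AGL1 F) | InfIrred K} =
    complementFamily F ∪ translationFamily F ∪ subfieldFamily F := by
  ext K
  rw [Set.mem_ofPred_eq, infIrred_iff_translationExtension_or_subfieldSubgroup, Set.union_comm
    (complementFamily F), Set.union_assoc]
  refine or_congr_right ⟨?_, ?_⟩
  · rintro ⟨L, A, g, hA, rfl⟩
    by_cases hL : L = ⊤
    · subst hL
      rw [isCoatom_iff_eq_bot_of_top.1 hA, subfieldSubgroup_top_bot]
      exact .inl ⟨g, rfl⟩
    · exact .inr ⟨L, A, g, hL, Submodule.finrank_add_one_eq_iff_isCoatom.2 hA, rfl⟩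
  · rintro (⟨g, rfl⟩ | ⟨L, A, g, -, hA, rfl⟩)
    · exact ⟨⊤, ⊥, g, isCoatom_iff_eq_bot_of_top.2 rfl, by rw [subfieldSubgroup_top_bot]⟩
    · exact ⟨L, A, g, Submodule.finrank_add_one_eq_iff_isCoatom.1 hA, rfl⟩

theorem finite_AGL1 [Finite F] : Finite (AGL1 F) :=
  have : Finite (Multiplicative F) := inferInstanceAs (Finite F)
  Finite.of_equiv _ SemidirectProduct.equivProd.symm

/-! ### Counting conjugacy classes -/

/-- Hyperplanes over the same subfield are scalings of one another, and conjugation by a scaling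
carries `A ⋊ Lˣ` to the corresponding subgroup. -/
theorem subgroupConjClass_subfieldSubgroup_eq [Finite F] {L : Subfield F} {A B : Submodule L F}
    (hA : IsCoatom A) (hB : IsCoatom B) :
    subgroupConjClass (subfieldSubgroup L A) = subgroupConjClass (subfieldSubgroup L B) := by
  obtain ⟨c, hc⟩ := exists_units_smul_of_isCoatom hA hB
  suffices h : conjSubgroup (scaling c⁻¹) (subfieldSubgroup L A) = subfieldSubgroup L B by
    rw [← h, subgroupConjClass_conjSubgroup]
  ext g
  have hl : Multiplicative.toAdd ((scaling c⁻¹)⁻¹ * g * scaling c⁻¹).left =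
      (c : F) * Multiplicative.toAdd g.left := by
    simp [scaling, affineAction_apply]
  have hr : ((scaling c⁻¹)⁻¹ * g * scaling c⁻¹).right = g.right := by
    simp [scaling]
  rw [mem_conjSubgroup, subfieldSubgroup, subfieldSubgroup, mem_semidirectSubgroup,
    mem_semidirectSubgroup, hl, hr]
  exact and_congr_left' (hc _).symm

theorem exists_isCoatom_submodule (L : Subfield F) : ∃ A : Submodule L F, IsCoatom A := by
  obtain ⟨A, hA, -⟩ := (eq_top_or_exists_le_coatom (⊥ : Submodule L F)).resolve_left bot_ne_top
  exact ⟨A, hA⟩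

/-- The conjugacy class of the subgroups `A ⋊ Lˣ`, where `A` is an `L`-hyperplane. -/
noncomputable def hyperplaneClass (L : Subfield F) : Set (Subgroup (AGL1 F)) :=
  subgroupConjClass (subfieldSubgroup L (exists_isCoatom_submodule L).choose)

theorem subgroupConjClass_subfieldSubgroup [Finite F] {L : Subfield F} {A : Submodule L F}
    (hA : IsCoatom A) : subgroupConjClass (subfieldSubgroup L A) = hyperplaneClass L :=
  subgroupConjClass_subfieldSubgroup_eq hA (exists_isCoatom_submodule L).choose_spec

theorem hyperplaneClass_injective :
    Function.Injective (hyperplaneClass : Subfield F → Set (Subgroup (AGL1 F))) := by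
  intro L M h
  have := linearPart_eq_of_subgroupConjClass_eq h
  rw [subfieldSubgroup, subfieldSubgroup, linearPart_semidirectSubgroup,
    linearPart_semidirectSubgroup] at this
  exact subfield_units_injective this

theorem image_complementFamily [Finite F] :
    subgroupConjClass '' complementFamily F = {hyperplaneClass ⊤} := by
  have h : ∀ g : AGL1 F, subgroupConjClass (conjSubgroup g (pointStabilizer F)) =
      hyperplaneClass ⊤ := fun g => by
    rw [subgroupConjClass_conjSubgroup, ← subfieldSubgroup_top_bot]
    exact subgroupConjClass_subfieldSubgroup (isCoatom_iff_eq_bot_of_top.2 rfl)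
  ext c
  constructor
  · rintro ⟨_, ⟨g, rfl⟩, rfl⟩
    exact h g
  · rintro rfl
    exact ⟨_, ⟨1, rfl⟩, h 1⟩

theorem image_subfieldFamily [Finite F] :
    subgroupConjClass '' subfieldFamily F = hyperplaneClass '' {⊤}ᶜ := by
  ext c
  constructor
  · rintro ⟨_, ⟨L, A, g, hL, hA, rfl⟩, rfl⟩
    refine ⟨L, hL, ?_⟩
    rw [subgroupConjClass_conjSubgroup,
      subgroupConjClass_subfieldSubgroup (Submodule.finrank_add_one_eq_iff_isCoatom.1 hA)]
  · rintro ⟨L, hL, rfl⟩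
    exact ⟨_, ⟨L, _, 1, hL, Submodule.finrank_add_one_eq_iff_isCoatom.2
      (exists_isCoatom_submodule L).choose_spec, (conjSubgroup_one _).symm⟩, rfl⟩

theorem image_translationFamily : subgroupConjClass '' translationFamily F =
    (fun D : Subgroup Fˣ => {translationExtension D}) '' {D | IsPrimePow D.index} := by
  have h : ∀ D : Subgroup Fˣ, subgroupConjClass (translationExtension D) =
      {translationExtension D} := by
    intro D
    ext K
    simp [subgroupConjClass, conjSubgroup_translationExtension]
  ext c
  constructor
  · rintro ⟨_, ⟨D, hD, rfl⟩, rfl⟩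
    exact ⟨D, hD, (h D).symm⟩
  · rintro ⟨D, hD, rfl⟩
    exact ⟨_, ⟨D, hD, rfl⟩, h D⟩

theorem numConjClasses_complementFamily [Finite F] : numConjClasses (complementFamily F) = 1 := by
  rw [numConjClasses, image_complementFamily, Set.ncard_singleton]

theorem numConjClasses_translationFamily [Finite F] : numConjClasses (translationFamily F) =
    ArithmeticFunction.cardFactors (Nat.card F - 1) := by
  have hinj : Function.Injective
      (fun D : Subgroup Fˣ => ({translationExtension D} : Set (Subgroup (AGL1 F)))) := by
    intro D E h
    have := congrArg linearPart (Set.singleton_injective h)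
    rwa [translationExtension, translationExtension, linearPart_semidirectSubgroup,
      linearPart_semidirectSubgroup] at this
  rw [numConjClasses, image_translationFamily, Set.ncard_image_of_injective _ hinj,
    ncard_subgroup_index_mem IsPrimePow, Nat.card_units,
    card_divisors_filter_isPrimePow _ (Nat.sub_ne_zero_of_lt Finite.one_lt_card)]

theorem numConjClasses_subfieldFamily [Finite F] :
    numConjClasses (subfieldFamily F) = Nat.card (Subfield F) - 1 := by
  have : Finite (Subfield F) := Finite.of_injective _ SetLike.coe_injective
  rw [numConjClasses, image_subfieldFamily, Set.ncard_image_of_injective _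
    hyperplaneClass_injective, Set.ncard_compl, Set.ncard_singleton]

theorem disjoint_range_hyperplaneClass_image_translationFamily :
    Disjoint (Set.range hyperplaneClass) (subgroupConjClass '' translationFamily F) := by
  rw [Set.disjoint_left]
  rintro _ ⟨L, rfl⟩ h
  rw [image_translationFamily] at h
  obtain ⟨D, -, hD⟩ := h
  have hmem : subfieldSubgroup L (exists_isCoatom_submodule L).choose ∈
      ({translationExtension D} : Set (Subgroup (AGL1 F))) := by
    rw [show ({translationExtension D} : Set (Subgroup (AGL1 F))) = hyperplaneClass L from hD]
    exact mem_subgroupConjClass_self _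
  have := congrArg translationPart (Set.mem_singleton_iff.1 hmem)
  rw [subfieldSubgroup, translationExtension, translationPart_semidirectSubgroup,
    translationPart_semidirectSubgroup] at this
  exact (exists_isCoatom_submodule L).choose_spec.1 (Submodule.toAddSubgroup_injective this)

theorem numConjClasses_infIrred [Finite F] :
    numConjClasses {K : Subgroup (AGL1 F) | InfIrred K} =
      ArithmeticFunction.cardFactors (Nat.card F - 1) + Nat.card (Subfield F) := by
  have := finite_AGL1 (F := F)
  rw [setOf_infIrred_eq, Set.union_right_comm, numConjClasses, Set.image_union, Set.image_union,
    image_complementFamily, image_subfieldFamily, ← Set.image_singleton, ← Set.image_union,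
    Set.union_compl_self, Set.image_univ,
    Set.ncard_union_eq disjoint_range_hyperplaneClass_image_translationFamily, ← Set.image_univ,
    Set.ncard_image_of_injective _ hyperplaneClass_injective, Set.ncard_univ, add_comm]
  exact congrArg (· + _) numConjClasses_translationFamily

end Affine

theorem theoremB (p n : ℕ) (hp : p.Prime) (hn : 1 ≤ n) (F : Type*) [Field F]
    (hF : Nat.card F = p ^ n) :
    -- the width, as the least size of a generating set of the complete transfer system
    width (AGL1 F) = ArithmeticFunction.cardFactors (p ^ n - 1) + n.divisors.card ∧
    -- every generating set that is minimal under inclusion has that size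
    (∀ S : Set (Subgroup (AGL1 F) × Subgroup (AGL1 F)),
      Minimal (completeTransferSystem (AGL1 F)).GeneratedBy S →
      S.ncard = ArithmeticFunction.cardFactors (p ^ n - 1) + n.divisors.card) ∧
    -- it is also the number of conjugacy classes of proper meet irreducible subgroups
    numConjClasses {K : Subgroup (AGL1 F) | InfIrred K} =
      ArithmeticFunction.cardFactors (p ^ n - 1) + n.divisors.card ∧
    -- the proper meet irreducible subgroups form three families
    {K : Subgroup (AGL1 F) | InfIrred K} =
      complementFamily F ∪ translationFamily F ∪ subfieldFamily F ∧
    -- the numbers of conjugacy classes in the families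
    numConjClasses (complementFamily F) = 1 ∧
    numConjClasses (translationFamily F) = ArithmeticFunction.cardFactors (p ^ n - 1) ∧
    numConjClasses (subfieldFamily F) = n.divisors.card - 1 := by
  have : Finite F := Nat.finite_of_card_ne_zero (hF ▸ pow_ne_zero n hp.ne_zero)
  have := finite_AGL1 (F := F)
  have hsub := card_subfield hp hF
  have hirr := numConjClasses_infIrred (F := F)
  rw [hF, hsub] at hirr
  refine ⟨by rw [width_eq_numConjClasses_infIrred, hirr],
    fun S hS => by rw [ncard_of_minimal_generatedBy hS, hirr], hirr, setOf_infIrred_eq,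
    numConjClasses_complementFamily, ?_, ?_⟩
  · rw [numConjClasses_translationFamily, hF]
  · rw [numConjClasses_subfieldFamily, hsub]
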